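/- All Hilbert spaces are finite-dimensional, of dimension at least $1$, with fixed orthonormal (product) bases; $d_X$ is the dimension of $\mathcal H_X$. For an operator $M$ on a tensor product containing the factor $\mathcal H_X$ put ${}_XM := \frac{\mathbb 1_X}{d_X}\otimes \operatorname{tr}_X M$. The link product of $F\in\mathcal B(\mathcal H_X\otimes\mathcal H_Y)$ and $L\in\mathcal B(\mathcal H_Y\otimes\mathcal H_Z)$ is $F\star L:=\operatorname{tr}_Y[(F\otimes\mathbb 1_Z)(\mathbb 1_X\otimes L^{\mathrm T_Y})]\in\mathcal B(\mathcal H_X\otimes\mathcal H_Z)$, where $\mathrm T_Y$ is the partial transpose on $Y$. A Choi matrix of a channel (CPTP map) from $P$ to $Q$ is a matrix $C\ge 0$ on $\mathcal H_P\otimes\mathcal H_Q$ with $\operatorname{tr}_QC=\mathbb 1_P$; it acts by $\mathcal C(\rho)=\operatorname{tr}_P[C(\rho^{\mathrm T}\otimes\mathbb 1_Q)]$. A bipartite channel $\mathcal N$ with inputs $A_I,B_I$ and outputs $A_O,B_O$ is non-signalling if, for all states $\rho,\xi$ on $A_I$ and $\eta,\zeta$ on $B_I$, $\operatorname{tr}_{A_O}\mathcal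 N(\rho\otimes\eta)=\operatorname{tr}_{A_O}\mathcal N(\xi\otimes\eta)$ and $\operatorname{tr}_{B_O}\mathcal N(\rho\otimes\eta)=\operatorname{tr}_{B_O}\mathcal N(\rho\otimes\zeta)$. Channels are identified with their Choi matrices. Fix spaces $X_I,X_I',X_O,X_O'$ for $X\in\{A,B\}$. Consider matrices $\Upsilon$ on the tensor product of these eight spaces. * $\Upsilon$ is a completely admissible adapter ($\Upsilon\in\Theta_{\mathtt{CA}}$) if $\Upsilon\ge0$ and, for all additional spaces $\bar A_I,\bar A_O,\bar B_I,\bar B_O$ and every non-signalling channel $\bar M$ with inputs $A_I'\bar A_I$ (Alice), $B_I'\bar B_I$ (Bob) and outputs $A_O'\bar A_O$ (Alice), $B_O'\bar B_O$ (Bob), the link product $\Upsilon\star\bar M$ over the spaces $A_I',A_O',B_I',B_O'$ is a non-signalling channel with inputs $A_I\bar A_I$ (Alice), $B_I\bar B_I$ (Bob) and outputs $A_O\bar A_O$ (Alice), $B_O\bar B_O$ (Bob). * $\Upsilon$ is a non-signalling adapter ($\Upsilon\in\Theta_{\mathtt{NS}}$) if $\Upsilon\ge0$, $\Upsilon=(L_A\otimes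 L_B)[\Upsilon]$ and $\operatorname{tr}\Upsilon=d_{A_I}d_{A_O'}d_{B_I}d_{B_O'}$, where $$L_X[\Upsilon]=\Upsilon-{}_{X_O}\Upsilon+{}_{X_OX_O'}\Upsilon-{}_{X_I'X_OX_O'}\Upsilon+{}_{X_IX_I'X_OX_O'}\Upsilon .$$ Then, for every choice of the spaces $A_I,A_I',A_O,A_O',B_I,B_I',B_O,B_O'$, $$\Theta_{\mathtt{CA}}=\Theta_{\mathtt{NS}} .$$ -/

import Mathlib

open scoped Kronecker ComplexOrder

/-! Operators on a finite-dimensional Hilbert space with a fixed orthonormal basis indexed by a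
finite non-empty type are complex square matrices over that type; tensor products of spaces
correspond to products of index types. -/

universe u

namespace NSAdapter



section Tensor

variable {I X Y Z S R : Type*}

/-- Partial trace over the first tensor factor. -/
def traceFst [Fintype S] (M : Matrix (S × R) (S × R) ℂ) : Matrix R R ℂ :=
  Matrix.of fun r r' => ∑ s, M (s, r) (s, r')

/-- Partial trace over the second tensor factor. -/
def traceSnd [Fintype R] (M : Matrix (S × R) (S × R) ℂ) : Matrix S S ℂ :=
  Matrix.of fun s s' => ∑ r, M (s, r) (s', r)

/-- Partial transpose of the first tensor factor. -/
def transposeFst (M : Matrix (S × R) (S × R) ℂ) : Matrix (S × R) (S × R) ℂ :=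
  Matrix.of fun p q => M (q.1, p.2) (p.1, q.2)

/-- The link product `F_{XY} ⋆ L_{YZ} = tr_Y [(F_{XY} ⊗ 1_Z) (1_X ⊗ L_{YZ}^{T_Y})]`. -/
def link [Fintype X] [Fintype Y] [Fintype Z] [DecidableEq X] [DecidableEq Z]
    (F : Matrix (X × Y) (X × Y) ℂ) (L : Matrix (Y × Z) (Y × Z) ℂ) :
    Matrix (X × Z) (X × Z) ℂ :=
  let lhs : Matrix ((X × Y) × Z) ((X × Y) × Z) ℂ := F ⊗ₖ (1 : Matrix Z Z ℂ)
  let rhs : Matrix ((X × Y) × Z) ((X × Y) × Z) ℂ :=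
    Matrix.reindex (Equiv.prodAssoc X Y Z).symm (Equiv.prodAssoc X Y Z).symm
      ((1 : Matrix X X ℂ) ⊗ₖ transposeFst L)
  let e : (X × Y) × Z ≃ Y × (X × Z) :=
    ((Equiv.prodComm X Y).prodCongr (Equiv.refl Z)).trans (Equiv.prodAssoc Y X Z)
  traceFst (Matrix.reindex e e (lhs * rhs))

/-- The operator `_S M = (1_S / d_S) ⊗ tr_S M`, where the equivalence `e` singles out the tensor
factor `S` inside the whole space. -/
noncomputable def replaceTrace [Fintype S] [DecidableEq S] (e : I ≃ S × R) (M : Matrix I I ℂ) :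
    Matrix I I ℂ :=
  Matrix.reindex e.symm e.symm
    (((Fintype.card S : ℂ)⁻¹ • (1 : Matrix S S ℂ)) ⊗ₖ traceFst (Matrix.reindex e e M))

/-- Density matrices. -/
def IsState [Fintype S] (ρ : Matrix S S ℂ) : Prop :=
  ρ.PosSemidef ∧ ρ.trace = 1

end Tensor

section Channels

variable {P Q V W : Type*}

/-- `C` is the Choi matrix, on input `⊗` output, of a CPTP map. -/
def IsChannel [Fintype V] [DecidableEq P] (C : Matrix (P × V) (P × V) ℂ) : Prop :=
  C.PosSemidef ∧ traceSnd C = 1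

/-- The map `ρ ↦ tr_{in} [C (ρᵀ ⊗ 1_{out})]` with Choi matrix `C`. -/
def applyChoi [Fintype P] [Fintype V] [DecidableEq V]
    (C : Matrix (P × V) (P × V) ℂ) (ρ : Matrix P P ℂ) : Matrix V V ℂ :=
  traceFst (C * (ρ.transpose ⊗ₖ (1 : Matrix V V ℂ)))

/-- `M` (on Alice's input `P` and output `V`, and Bob's input `Q` and output `W`) is the Choi
matrix of a bipartite channel `P ⊗ Q → V ⊗ W` which is non-signalling in both directions: the
reduced output state of one party does not depend on the input state of the other party. -/
def IsNonSignallingChannel [Fintype P] [Fintype Q] [Fintype V] [Fintype W]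
    [DecidableEq P] [DecidableEq Q] [DecidableEq V] [DecidableEq W]
    (M : Matrix ((P × V) × (Q × W)) ((P × V) × (Q × W)) ℂ) : Prop :=
  let C : Matrix ((P × Q) × (V × W)) ((P × Q) × (V × W)) ℂ :=
    Matrix.reindex (Equiv.prodProdProdComm P V Q W) (Equiv.prodProdProdComm P V Q W) M
  IsChannel C ∧
  (∀ (ρ ξ : Matrix P P ℂ) (η : Matrix Q Q ℂ), IsState ρ → IsState ξ → IsState η →
    traceFst (applyChoi C (ρ ⊗ₖ η)) = traceFst (applyChoi C (ξ ⊗ₖ η))) ∧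
  (∀ (ρ : Matrix P P ℂ) (η ζ : Matrix Q Q ℂ), IsState ρ → IsState η → IsState ζ →
    traceSnd (applyChoi C (ρ ⊗ₖ η)) = traceSnd (applyChoi C (ρ ⊗ₖ ζ)))

end Channels

/-- The index type of one party holding two input spaces `XI`, `YI` and two output spaces
`XO`, `YO`, ordered as `(XI ⊗ YI) ⊗ (XO ⊗ YO)`. -/
abbrev Party (XI YI XO YO : Type*) := (XI × YI) × (XO × YO)

/-- Reordering of the tensor factors of a bipartite operator, separating for both parties the
first input and output spaces from the second ones. -/
def splitLegs (a a' b b' c c' d d' : Type*) :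
    Party a a' b b' × Party c c' d d' ≃ ((a × b) × (c × d)) × ((a' × b') × (c' × d')) where
  toFun p := (((p.1.1.1, p.1.2.1), (p.2.1.1, p.2.2.1)), ((p.1.1.2, p.1.2.2), (p.2.1.2, p.2.2.2)))
  invFun q := (((q.1.1.1, q.2.1.1), (q.1.1.2, q.2.1.2)), ((q.1.2.1, q.2.2.1), (q.1.2.2, q.2.2.2)))
  left_inv _ := rfl
  right_inv _ := rfl

section Adapters

variable {AI AI' AO AO' BI BI' BO BO' : Type u}

/-- The action `Υ ⋆ M` of an adapter `Υ` on `A A' B B'` on an operator `M` on `A' Ā B' B̄`: the link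
product over the primed spaces, with result on `A Ā B B̄`. -/
def adapterAction
    [Fintype AI] [Fintype AI'] [Fintype AO] [Fintype AO']
    [Fintype BI] [Fintype BI'] [Fintype BO] [Fintype BO']
    [DecidableEq AI] [DecidableEq AO] [DecidableEq BI] [DecidableEq BO]
    {AIbar AObar BIbar BObar : Type*}
    [Fintype AIbar] [Fintype AObar] [Fintype BIbar] [Fintype BObar]
    [DecidableEq AIbar] [DecidableEq AObar] [DecidableEq BIbar] [DecidableEq BObar]
    (U : Matrix (Party AI AI' AO AO' × Party BI BI' BO BO')
      (Party AI AI' AO AO' × Party BI BI' BO BO') ℂ)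
    (M : Matrix (Party AI' AIbar AO' AObar × Party BI' BIbar BO' BObar)
      (Party AI' AIbar AO' AObar × Party BI' BIbar BO' BObar) ℂ) :
    Matrix (Party AI AIbar AO AObar × Party BI BIbar BO BObar)
      (Party AI AIbar AO AObar × Party BI BIbar BO BObar) ℂ :=
  let eU := splitLegs AI AI' AO AO' BI BI' BO BO'
  let eM := splitLegs AI' AIbar AO' AObar BI' BIbar BO' BObar
  let eN := splitLegs AI AIbar AO AObar BI BIbar BO BObar
  Matrix.reindex eN.symm eN.symm (link (Matrix.reindex eU eU U) (Matrix.reindex eM eM M))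

/-- The set of completely admissible adapters: positive semidefinite matrices that map every
non-signalling channel, extended by arbitrary additional (barred) spaces, to a non-signalling
channel. -/
def completelyAdmissibleAdapters (AI AI' AO AO' BI BI' BO BO' : Type u)
    [Fintype AI] [Fintype AI'] [Fintype AO] [Fintype AO']
    [Fintype BI] [Fintype BI'] [Fintype BO] [Fintype BO']
    [DecidableEq AI] [DecidableEq AI'] [DecidableEq AO] [DecidableEq AO']
    [DecidableEq BI] [DecidableEq BI'] [DecidableEq BO] [DecidableEq BO'] :
    Set (Matrix (Party AI AI' AO AO' × Party BI BI' BO BO')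
      (Party AI AI' AO AO' × Party BI BI' BO BO') ℂ) :=
  {U | U.PosSemidef ∧
    ∀ (AIbar AObar BIbar BObar : Type u)
      [Fintype AIbar] [Fintype AObar] [Fintype BIbar] [Fintype BObar]
      [DecidableEq AIbar] [DecidableEq AObar] [DecidableEq BIbar] [DecidableEq BObar]
      [Nonempty AIbar] [Nonempty AObar] [Nonempty BIbar] [Nonempty BObar]
      (M : Matrix (Party AI' AIbar AO' AObar × Party BI' BIbar BO' BObar)
        (Party AI' AIbar AO' AObar × Party BI' BIbar BO' BObar) ℂ),
      IsNonSignallingChannel M → IsNonSignallingChannel (adapterAction U M)}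

end Adapters

section Projectors

variable {I R XI XI' XO XO' : Type*}

/-- Singling out the leg `X_O` of party `X`, where `R` is the rest of the space. -/
def legO (XI XI' XO XO' R : Type*) : Party XI XI' XO XO' × R ≃ XO × ((XI × XI') × XO' × R) where
  toFun p := (p.1.2.1, (p.1.1, p.1.2.2, p.2))
  invFun q := ((q.2.1, (q.1, q.2.2.1)), q.2.2.2)
  left_inv _ := rfl
  right_inv _ := rfl

/-- Singling out the legs `X_O X_O'`. -/
def legOO' (XI XI' XO XO' R : Type*) :
    Party XI XI' XO XO' × R ≃ (XO × XO') × ((XI × XI') × R) where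
  toFun p := (p.1.2, (p.1.1, p.2))
  invFun q := ((q.2.1, q.1), q.2.2)
  left_inv _ := rfl
  right_inv _ := rfl

/-- Singling out the legs `X_I' X_O X_O'`. -/
def legI'OO' (XI XI' XO XO' R : Type*) :
    Party XI XI' XO XO' × R ≃ (XI' × (XO × XO')) × (XI × R) where
  toFun p := ((p.1.1.2, p.1.2), (p.1.1.1, p.2))
  invFun q := (((q.2.1, q.1.1), q.1.2), q.2.2)
  left_inv _ := rfl
  right_inv _ := rfl

/-- The operator
`L_X[Υ] = Υ - _{X_O}Υ + _{X_O X_O'}Υ - _{X_I' X_O X_O'}Υ + _{X_I X_I' X_O X_O'}Υ`,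
where the equivalence `g` singles out the legs of party `X`. -/
noncomputable def projL [Fintype XI] [Fintype XI'] [Fintype XO] [Fintype XO']
    [DecidableEq XI] [DecidableEq XI'] [DecidableEq XO] [DecidableEq XO']
    (g : I ≃ Party XI XI' XO XO' × R) (U : Matrix I I ℂ) : Matrix I I ℂ :=
  U - replaceTrace (g.trans (legO XI XI' XO XO' R)) U
    + replaceTrace (g.trans (legOO' XI XI' XO XO' R)) U
    - replaceTrace (g.trans (legI'OO' XI XI' XO XO' R)) U
    + replaceTrace g U

/-- The set of non-signalling adapters. As `L_A` and `L_B` act on different tensor factors,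
`L_A ⊗ L_B` is the composition of `L_A ⊗ id` and `id ⊗ L_B`. -/
def nonSignallingAdapters (AI AI' AO AO' BI BI' BO BO' : Type u)
    [Fintype AI] [Fintype AI'] [Fintype AO] [Fintype AO']
    [Fintype BI] [Fintype BI'] [Fintype BO] [Fintype BO']
    [DecidableEq AI] [DecidableEq AI'] [DecidableEq AO] [DecidableEq AO']
    [DecidableEq BI] [DecidableEq BI'] [DecidableEq BO] [DecidableEq BO'] :
    Set (Matrix (Party AI AI' AO AO' × Party BI BI' BO BO')
      (Party AI AI' AO AO' × Party BI BI' BO BO') ℂ) :=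
  {U | U.PosSemidef ∧
    U = projL (Equiv.refl (Party AI AI' AO AO' × Party BI BI' BO BO'))
      (projL (Equiv.prodComm (Party AI AI' AO AO') (Party BI BI' BO BO')) U) ∧
    U.trace = (Fintype.card AI : ℂ) * Fintype.card AO' * Fintype.card BI * Fintype.card BO'}

end Projectors

end NSAdapter

/-! Both sets are cut out by the same kind of condition: positivity, one linear condition per party,
and a trace. The linear conditions are imposed on blocks, that is, on one party's matrix with the
other party's row and column indices fixed. By linearity, non-signalling means that every block of a
party lies in `channelSpan` (`isNonSignallingChannel_iff`). `L_X` is a projection onto `combSpan`,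
so the fixed-point equation of `nonSignallingAdapters` means that every block lies in `combSpan`
(`mem_nonSignallingAdapters_iff`).

For `nonSignallingAdapters ⊆ completelyAdmissibleAdapters`: the blocks of `adapterAction U M` are
sums of one-party link products of blocks of `U` and `M`, and such a product sends a comb and a
channel to a channel, with multiplicative traces (`partyAction_mem_channelSpan`). Positivity is
`posSemidef_link`.

Conversely, product test channels suffice. Linking a party with `crossChannel` exposes its inner
legs and so isolates the blocks of the other party; on that other party, `crossChannel` and
`bellChannel` together force the comb conditions (`mem_combSpan_of_partyAction`). The trace is read
off from `crossChannel` on both sides. -/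

namespace NSAdapter

/-! ### One-party blocks of bipartite matrices. -/

section Blocks

variable {S R : Type*}

/-- The block of a bipartite matrix acting on the first factor, for fixed indices of the second. -/
def fstBlock (U : Matrix (S × R) (S × R) ℂ) (r r' : R) : Matrix S S ℂ :=
  Matrix.of fun s s' => U (s, r) (s', r')

/-- The block of a bipartite matrix acting on the second factor, for fixed indices of the first. -/
def sndBlock (U : Matrix (S × R) (S × R) ℂ) (s s' : S) : Matrix R R ℂ :=
  Matrix.of fun r r' => U (s, r) (s', r')

theorem trace_eq_sum_trace_fstBlock [Fintype S] [Fintype R] (U : Matrix (S × R) (S × R) ℂ) :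
    U.trace = ∑ r, (fstBlock U r r).trace := by
  simp [Matrix.trace, fstBlock, Fintype.sum_prod_type_right]

theorem trace_eq_sum_trace_sndBlock [Fintype S] [Fintype R] (U : Matrix (S × R) (S × R) ℂ) :
    U.trace = ∑ s, (sndBlock U s s).trace := by
  simp [Matrix.trace, sndBlock, Fintype.sum_prod_type]

end Blocks

/-! ### Linear functionals that are constant on states. -/

section States

variable {P : Type*} [Fintype P] [DecidableEq P]

theorem isState_single (i : P) : IsState (Matrix.single i i (1 : ℂ)) := by
  refine ⟨?_, by simp⟩
  have h := Matrix.posSemidef_vecMulVec_self_star (Pi.single i (1 : ℂ))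
  convert h using 1
  ext a b
  by_cases ha : a = i <;> by_cases hb : b = i <;>
    simp [Matrix.vecMulVec_apply, ha, hb, Ne.symm]

/-- The pure state proportional to `|i⟩ + z |j⟩`, for `|z| = 1`. -/
noncomputable def superposition (i j : P) (z : ℂ) : Matrix P P ℂ :=
  (2⁻¹ : ℂ) • (Matrix.single i i 1 + Matrix.single j j 1
    + Matrix.single j i z + Matrix.single i j (star z))

theorem isState_superposition {i j : P} (hij : i ≠ j) {z : ℂ} (hz : z * star z = 1) :
    IsState (superposition i j z) := by
  constructor
  · have h := Matrix.posSemidef_vecMulVec_self_star (Pi.single (M := fun _ => ℂ) i 1 + Pi.single j z)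
    have h2 : (0 : ℂ) ≤ 2⁻¹ := by positivity
    convert h.smul h2 using 1
    unfold superposition
    congr 1
    clear h h2
    rw [Complex.star_def] at *
    ext a b
    simp only [Matrix.add_apply, Matrix.single_apply, Matrix.vecMulVec_apply, Pi.add_apply,
      Pi.single_apply, Pi.star_apply]
    by_cases h1 : i = a <;> by_cases h2 : i = b <;> by_cases h3 : j = a <;> by_cases h4 : j = b <;>
      simp_all [Ne.symm]
  · simp [superposition, Matrix.trace_add, Matrix.trace_single_eq_of_ne, hij, hij.symm]
    norm_num

theorem sum_mul_single (t : P → P → ℂ) (i j : P) (z : ℂ) :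
    ∑ p, ∑ p', t p p' * Matrix.single i j z p p' = t i j * z := by
  simp [Matrix.single_apply, ite_and]

/-- A functional on matrices which is constant on states is a multiple of the trace. -/
theorem eq_ite_of_forall_isState (t : P → P → ℂ)
    (h : ∀ ρ ξ : Matrix P P ℂ, IsState ρ → IsState ξ →
      ∑ p, ∑ p', t p p' * ρ p p' = ∑ p, ∑ p', t p p' * ξ p p') :
    ∃ c, ∀ p p', t p p' = if p = p' then c else 0 := by
  rcases isEmpty_or_nonempty P with hP | ⟨⟨p₀⟩⟩
  · exact ⟨0, fun p => hP.elim p⟩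
  have hs := sum_mul_single t
  have hd : ∀ i, t i i = t p₀ p₀ := by
    intro i
    simpa [hs] using h _ _ (isState_single i) (isState_single p₀)
  have hp : ∀ i j z, ∑ p, ∑ p', t p p' * superposition i j z p p'
      = 2⁻¹ * (t i i + t j j + t j i * z + t i j * star z) := by
    intro i j z
    rw [← mul_one (t i i), ← mul_one (t j j)]
    rw [← hs i i 1, ← hs j j 1, ← hs j i z, ← hs i j (star z)]
    simp only [← Finset.sum_add_distrib, Finset.mul_sum]
    refine Finset.sum_congr rfl fun p _ => Finset.sum_congr rfl fun p' _ => ?_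
    simp [superposition]
    ring
  refine ⟨t p₀ p₀, fun i j => ?_⟩
  split_ifs with hij
  · rw [← hij, hd]
  -- The phases `1` and `I` give `t i j + t j i = 0` and `I * (t j i - t i j) = 0` up to a factor;
  -- the final combination isolates `t i j`.
  · have h1 := h _ _ (isState_superposition (z := 1) hij (by simp)) (isState_single p₀)
    have h2 := h _ _ (isState_superposition (z := Complex.I) hij (by simp)) (isState_single p₀)
    rw [hp, hs, hd i, hd j] at h1 h2
    simp only [star_one, Complex.star_def, Complex.conj_I] at h1 h2
    linear_combination h1 + Complex.I * h2 + 2⁻¹ * (t i j - t j i) * Complex.I_mul_I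

theorem eq_zero_of_forall_isState (t : P → P → ℂ)
    (h : ∀ ρ : Matrix P P ℂ, IsState ρ → ∑ p, ∑ p', t p p' * ρ p p' = 0) (p p' : P) :
    t p p' = 0 := by
  obtain ⟨c, hc⟩ := eq_ite_of_forall_isState t fun ρ ξ hρ hξ => by rw [h ρ hρ, h ξ hξ]
  have h1 := h _ (isState_single p)
  have h2 : c = 0 := by
    simpa only [sum_mul_single, hc, if_true, mul_one] using h1
  rw [hc, h2, ite_self]

variable {Q : Type*} [Fintype Q] [DecidableEq Q]

/-- For fixed `ρ` and `ξ`, the difference of the two sides is a functional of `η` that kills all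
states, so its coefficients vanish. The hypothesis on product states thus holds for each `q`, `q'`
separately. -/
theorem exists_eq_ite_of_forall_isState (t : P → P → Q → Q → ℂ)
    (h : ∀ (ρ ξ : Matrix P P ℂ) (η : Matrix Q Q ℂ), IsState ρ → IsState ξ → IsState η →
      ∑ q, ∑ q', (∑ p, ∑ p', t p p' q q' * ρ p p') * η q q' =
        ∑ q, ∑ q', (∑ p, ∑ p', t p p' q q' * ξ p p') * η q q') (q q' : Q) :
    ∃ c, ∀ p p', t p p' q q' = if p = p' then c else 0 := by
  refine eq_ite_of_forall_isState _ fun ρ ξ hρ hξ => ?_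
  rw [← sub_eq_zero]
  refine eq_zero_of_forall_isState (fun q q' => (∑ p, ∑ p', t p p' q q' * ρ p p') -
    ∑ p, ∑ p', t p p' q q' * ξ p p') (fun η hη => ?_) q q'
  simp only [sub_mul, Finset.sum_sub_distrib, h ρ ξ η hρ hξ hη, sub_self]

theorem sum_ite_mul_of_isState (c : ℂ) {ρ : Matrix P P ℂ} (hρ : IsState ρ) :
    ∑ p, ∑ p', (if p = p' then c else 0) * ρ p p' = c := by
  have h := hρ.2
  rw [Matrix.trace] at h
  simp only [ite_mul, zero_mul, Finset.sum_ite_eq, Finset.mem_univ, if_true, ← Finset.mul_sum]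
  simpa using congrArg (c * ·) h

/-- Being a multiple of the identity in each factor separately forces a multiple of the identity on
the product: the scalar for `q`, `q'` can be read at `p = p' = p₀`, where it is diagonal and
constant in `q`. -/
theorem exists_eq_ite_ite {P Q : Type*} [DecidableEq P] [DecidableEq Q] (f : P → P → Q → Q → ℂ)
    (hP : ∀ q q', ∃ c, ∀ p p', f p p' q q' = if p = p' then c else 0)
    (hQ : ∀ p p', ∃ c, ∀ q q', f p p' q q' = if q = q' then c else 0) :
    ∃ c, ∀ p p' q q', f p p' q q' = if p = p' then if q = q' then c else 0 else 0 := by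
  choose a ha using hP
  choose b hb using hQ
  rcases isEmpty_or_nonempty P with h | ⟨⟨p₀⟩⟩
  · exact ⟨0, fun p => h.elim p⟩
  rcases isEmpty_or_nonempty Q with h | ⟨⟨q₀⟩⟩
  · exact ⟨0, fun _ _ q => h.elim q⟩
  refine ⟨b p₀ p₀, fun p p' q q' => ?_⟩
  rw [ha]
  split_ifs with h1 h2 <;> have h3 := hb p₀ p₀ q q' <;> simp_all

end States

/-! ### Non-signalling channels as a linear condition on blocks. -/

section Channels

variable {P Q V W : Type*}

/-- The span of the Choi matrices of channels: the matrices with partial trace over the output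
proportional to the identity. -/
def channelSpan (P V : Type*) [Fintype V] [DecidableEq P] :
    Submodule ℂ (Matrix (P × V) (P × V) ℂ) where
  carrier := {C | ∃ c, ∀ p p', ∑ v, C (p, v) (p', v) = if p = p' then c else 0}
  zero_mem' := ⟨0, by simp⟩
  add_mem' := by
    rintro C D ⟨c, hc⟩ ⟨d, hd⟩
    refine ⟨c + d, fun p p' => ?_⟩
    simp only [Matrix.add_apply, Finset.sum_add_distrib, hc, hd]
    split_ifs <;> simp
  smul_mem' := by
    rintro z C ⟨c, hc⟩
    refine ⟨z * c, fun p p' => ?_⟩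
    simp only [Matrix.smul_apply, smul_eq_mul, ← Finset.mul_sum, hc]
    split_ifs <;> simp

theorem mem_channelSpan [Fintype V] [DecidableEq P] {C : Matrix (P × V) (P × V) ℂ} :
    C ∈ channelSpan P V ↔ ∃ c, ∀ p p', ∑ v, C (p, v) (p', v) = if p = p' then c else 0 :=
  Iff.rfl

theorem IsChannel.mem_channelSpan [Fintype V] [DecidableEq P] {C : Matrix (P × V) (P × V) ℂ}
    (hC : IsChannel C) : C ∈ channelSpan P V :=
  ⟨1, fun p p' => by simpa [traceSnd, Matrix.one_apply] using congrFun₂ hC.2 p p'⟩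

variable [Fintype P] [Fintype Q] [Fintype V] [Fintype W] [DecidableEq V] [DecidableEq W]

/-- Each entry of the reduced output is a bilinear functional of the two input states, which is the
form needed for the lemmas on functionals constant on states. -/
theorem traceFst_applyChoi_apply (M : Matrix ((P × V) × (Q × W)) ((P × V) × (Q × W)) ℂ)
    (ρ : Matrix P P ℂ) (η : Matrix Q Q ℂ) (w w' : W) :
    traceFst (applyChoi (Matrix.reindex (Equiv.prodProdProdComm P V Q W)
      (Equiv.prodProdProdComm P V Q W) M) (ρ ⊗ₖ η)) w w' =
    ∑ q, ∑ q', (∑ p, ∑ p', (∑ v, M ((p, v), (q, w)) ((p', v), (q', w'))) * ρ p p') * η q q' := by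
  simp only [traceFst, applyChoi, Matrix.of_apply, Matrix.mul_apply, Fintype.sum_prod_type,
    Matrix.kroneckerMap_apply, Matrix.transpose_apply, Matrix.one_apply, Matrix.reindex_apply,
    Matrix.submatrix_apply, Prod.mk.injEq, ite_and]
  simp only [mul_ite, mul_one, mul_zero, Finset.sum_ite_eq', Finset.mem_univ,
    if_true, Finset.sum_mul, Finset.sum_const_zero, Finset.sum_ite_irrel]
  simp only [← Fintype.sum_prod_type']
  refine Fintype.sum_equiv
    ⟨fun x => (x.2.2.1, x.2.2.2.2, x.2.1, x.2.2.2.1, x.1),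
      fun x => (x.2.2.2.2, x.2.2.1, x.1, x.2.2.2.1, x.2.1), fun _ => rfl, fun _ => rfl⟩
    _ _ fun x => ?_
  simp [Equiv.prodProdProdComm, mul_assoc]

theorem traceSnd_applyChoi_apply (M : Matrix ((P × V) × (Q × W)) ((P × V) × (Q × W)) ℂ)
    (ρ : Matrix P P ℂ) (η : Matrix Q Q ℂ) (v v' : V) :
    traceSnd (applyChoi (Matrix.reindex (Equiv.prodProdProdComm P V Q W)
      (Equiv.prodProdProdComm P V Q W) M) (ρ ⊗ₖ η)) v v' =
    ∑ p, ∑ p', (∑ q, ∑ q', (∑ w, M ((p, v), (q, w)) ((p', v'), (q', w))) * η q q') * ρ p p' := by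
  simp only [traceSnd, traceFst, applyChoi, Matrix.of_apply, Matrix.mul_apply,
    Fintype.sum_prod_type,
    Matrix.kroneckerMap_apply, Matrix.transpose_apply, Matrix.one_apply, Matrix.reindex_apply,
    Matrix.submatrix_apply, Prod.mk.injEq, ite_and]
  simp only [mul_ite, mul_one, mul_zero, Finset.sum_ite_eq', Finset.mem_univ,
    if_true, Finset.sum_mul, Finset.sum_const_zero, Finset.sum_ite_irrel]
  simp only [← Fintype.sum_prod_type']
  refine Fintype.sum_equiv
    ⟨fun x => (x.2.1, x.2.2.2.1, x.2.2.1, x.2.2.2.2, x.1),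
      fun x => (x.2.2.2.2, x.1, x.2.2.1, x.2.1, x.2.2.2.1), fun _ => rfl, fun _ => rfl⟩
    _ _ fun x => ?_
  simp [Equiv.prodProdProdComm, mul_assoc, mul_comm (ρ _ _)]

/-- Linear characterization of non-signalling channels: a positive semidefinite matrix of the
right trace is a non-signalling channel iff all its one-party blocks lie in the span of the
channels of that party. -/
theorem isNonSignallingChannel_iff [DecidableEq P] [DecidableEq Q] [Nonempty P] [Nonempty Q]
    {M : Matrix ((P × V) × (Q × W)) ((P × V) × (Q × W)) ℂ} :
    IsNonSignallingChannel M ↔ M.PosSemidef ∧ (∀ r r', fstBlock M r r' ∈ channelSpan P V) ∧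
      (∀ s s', sndBlock M s s' ∈ channelSpan Q W) ∧
      M.trace = Fintype.card P * Fintype.card Q := by
  have htr : traceSnd (Matrix.reindex (Equiv.prodProdProdComm P V Q W)
      (Equiv.prodProdProdComm P V Q W) M) = 1 ↔ ∀ p p' q q',
      ∑ v, ∑ w, M ((p, v), (q, w)) ((p', v), (q', w)) =
        if p = p' then if q = q' then 1 else 0 else 0 := by
    rw [← Matrix.ext_iff]
    simp only [Prod.forall, traceSnd, Matrix.of_apply, Fintype.sum_prod_type, Matrix.reindex_apply,
      Matrix.submatrix_apply, Matrix.one_apply, Prod.mk.injEq, ite_and]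
    exact ⟨fun h p p' q q' => h p q p' q', fun h p q p' q' => h p p' q q'⟩
  unfold IsNonSignallingChannel IsChannel
  simp only [htr]
  simp only [← Matrix.ext_iff, traceFst_applyChoi_apply, traceSnd_applyChoi_apply]
  rw [Matrix.reindex_apply, Matrix.posSemidef_submatrix_equiv]
  constructor
  · rintro ⟨⟨hpos, hone⟩, hA, hB⟩
    obtain ⟨p₀⟩ := ‹Nonempty P›
    obtain ⟨q₀⟩ := ‹Nonempty Q›
    refine ⟨hpos, ?_, ?_, ?_⟩
    · rintro ⟨q, w⟩ ⟨q', w'⟩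
      exact exists_eq_ite_of_forall_isState
        (fun p p' q q' => ∑ v, M ((p, v), (q, w)) ((p', v), (q', w')))
        (fun ρ ξ η hρ hξ hη => hA ρ ξ η hρ hξ hη w w') q q'
    · rintro ⟨p, v⟩ ⟨p', v'⟩
      exact exists_eq_ite_of_forall_isState
        (fun q q' p p' => ∑ w, M ((p, v), (q, w)) ((p', v'), (q', w)))
        (fun η ζ ρ hη hζ hρ => hB ρ η ζ hρ hη hζ v v') p p'
    · simp only [Matrix.trace, Matrix.diag_apply, Fintype.sum_prod_type]
      have h (p : P) : ∑ v, ∑ q, ∑ w, M ((p, v), (q, w)) ((p, v), (q, w)) = Fintype.card Q := by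
        rw [Finset.sum_comm]
        simp [hone]
      simp [h]
  · rintro ⟨hpos, hA, hB, htrace⟩
    -- Summing the block conditions over the other party's output, with equal row and column output
    -- indices, makes the output trace a multiple of the identity in each input. Hence it equals `c`
    -- times the identity, and the prescribed trace gives `c = 1`.
    obtain ⟨c, hc⟩ := exists_eq_ite_ite
      (fun p p' q q' => ∑ v, ∑ w, M ((p, v), (q, w)) ((p', v), (q', w))) (fun q q' => by
        choose a ha using fun w => hA (q, w) (q', w)
        refine ⟨∑ w, a w, fun p p' => ?_⟩
        rw [Finset.sum_comm]
        refine (Finset.sum_congr rfl fun w _ => ha w p p').trans ?_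
        split_ifs <;> simp) (fun p p' => by
        choose b hb using fun v => hB (p, v) (p', v)
        refine ⟨∑ v, b v, fun q q' => ?_⟩
        refine (Finset.sum_congr rfl fun v _ => hb v q q').trans ?_
        split_ifs <;> simp)
    refine ⟨⟨hpos, ?_⟩, fun ρ ξ η hρ hξ hη w w' => ?_, fun ρ η ζ hρ hη hζ v v' => ?_⟩
    · have h1 : c = 1 := by
        simp only [Matrix.trace, Matrix.diag_apply, Fintype.sum_prod_type] at htrace
        have h (p : P) : ∑ v, ∑ q, ∑ w, M ((p, v), (q, w)) ((p, v), (q, w))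
            = Fintype.card Q * c := by
          rw [Finset.sum_comm]
          simp [hc]
        simpa [h, mul_assoc] using htrace
      rwa [h1] at hc
    · refine Finset.sum_congr rfl fun q _ => Finset.sum_congr rfl fun q' _ => ?_
      obtain ⟨a, ha⟩ := hA (q, w) (q', w')
      simp only [fstBlock, Matrix.of_apply] at ha
      simp only [ha, sum_ite_mul_of_isState _ hρ, sum_ite_mul_of_isState _ hξ]
    · refine Finset.sum_congr rfl fun p _ => Finset.sum_congr rfl fun p' _ => ?_
      obtain ⟨b, hb⟩ := hB (p, v) (p', v')
      simp only [sndBlock, Matrix.of_apply] at hb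
      simp only [hb, sum_ite_mul_of_isState _ hη, sum_ite_mul_of_isState _ hζ]

end Channels

/-! ### One-slot combs and the projection `L_X`. -/

section Combs

variable {XI XI' XO XO' R I : Type*} [Fintype XI] [Fintype XI'] [Fintype XO] [Fintype XO']
  [DecidableEq XI] [DecidableEq XI'] [DecidableEq XO] [DecidableEq XO']

/-- The span of the one-slot combs `X_I → X_I'`, `X_O' → X_O` of a single party. -/
def combSpan (XI XI' XO XO' : Type*) [Fintype XI'] [Fintype XO] [DecidableEq XI]
    [DecidableEq XO'] : Submodule ℂ (Matrix (Party XI XI' XO XO') (Party XI XI' XO XO') ℂ) where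
  carrier := {Y | ∃ (K : XI × XI' → XI × XI' → ℂ) (k : ℂ),
    (∀ i j o' p', ∑ o, Y (i, (o, o')) (j, (o, p')) = if o' = p' then K i j else 0) ∧
    ∀ i j, ∑ i', K (i, i') (j, i') = if i = j then k else 0}
  zero_mem' := ⟨0, 0, by simp, by simp⟩
  add_mem' := by
    rintro Y Z ⟨K, k, hK, hk⟩ ⟨L, l, hL, hl⟩
    refine ⟨K + L, k + l, fun i j o' p' => ?_, fun i j => ?_⟩
    · simp only [Matrix.add_apply, Finset.sum_add_distrib, hK, hL, Pi.add_apply]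
      split_ifs <;> simp
    · simp only [Pi.add_apply, Finset.sum_add_distrib, hk, hl]
      split_ifs <;> simp
  smul_mem' := by
    rintro z Y ⟨K, k, hK, hk⟩
    refine ⟨z • K, z * k, fun i j o' p' => ?_, fun i j => ?_⟩
    · simp only [Matrix.smul_apply, smul_eq_mul, ← Finset.mul_sum, hK, Pi.smul_apply]
      split_ifs <;> simp
    · simp only [Pi.smul_apply, smul_eq_mul, ← Finset.mul_sum, hk]
      split_ifs <;> simp

omit [Fintype XI] [Fintype XO'] [DecidableEq XI'] [DecidableEq XO] in
theorem mem_combSpan {Y : Matrix (Party XI XI' XO XO') (Party XI XI' XO XO') ℂ} :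
    Y ∈ combSpan XI XI' XO XO' ↔ ∃ (K : XI × XI' → XI × XI' → ℂ) (k : ℂ),
      (∀ i j o' p', ∑ o, Y (i, (o, o')) (j, (o, p')) = if o' = p' then K i j else 0) ∧
      ∀ i j, ∑ i', K (i, i') (j, i') = if i = j then k else 0 :=
  Iff.rfl

theorem replaceTrace_apply {S : Type*} [Fintype S] [DecidableEq S] (e : I ≃ S × R)
    (M : Matrix I I ℂ) (x x' : I) :
    replaceTrace e M x x' = if (e x).1 = (e x').1 then
      (Fintype.card S : ℂ)⁻¹ * ∑ s, M (e.symm (s, (e x).2)) (e.symm (s, (e x').2)) else 0 := by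
  simp [replaceTrace, traceFst, Matrix.one_apply]

/-- The operator `L_X` on the matrices of party `X` alone. -/
noncomputable def partyL (Y : Matrix (Party XI XI' XO XO') (Party XI XI' XO XO') ℂ) :
    Matrix (Party XI XI' XO XO') (Party XI XI' XO XO') ℂ :=
  Matrix.of fun x x' => Y x x'
    - (if x.2.1 = x'.2.1 then
        (Fintype.card XO : ℂ)⁻¹ * ∑ o, Y (x.1, (o, x.2.2)) (x'.1, (o, x'.2.2)) else 0)
    + (if x.2 = x'.2 then
        (Fintype.card (XO × XO') : ℂ)⁻¹ * ∑ s, Y (x.1, s) (x'.1, s) else 0)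
    - (if (x.1.2, x.2) = (x'.1.2, x'.2) then
        (Fintype.card (XI' × (XO × XO')) : ℂ)⁻¹ *
          ∑ s : XI' × (XO × XO'), Y ((x.1.1, s.1), s.2) ((x'.1.1, s.1), s.2) else 0)
    + (if x = x' then (Fintype.card (Party XI XI' XO XO') : ℂ)⁻¹ * ∑ s, Y s s else 0)

theorem projL_apply (g : I ≃ Party XI XI' XO XO' × R) (U : Matrix I I ℂ) (x x' : I) :
    projL g U x x' =
      partyL (fstBlock (Matrix.reindex g g U) (g x).2 (g x').2) (g x).1 (g x').1 := by
  simp only [projL, Matrix.add_apply, Matrix.sub_apply, replaceTrace_apply, partyL,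
    Matrix.of_apply, fstBlock, Matrix.reindex_apply, Matrix.submatrix_apply]
  simp [legO, legOO', legI'OO']
  rfl

/-- The alternating terms of `L_X` cancel in pairs. Tracing out `XO` cancels the first two, and the
remaining three are proportional to the identity on `XO'`: they form the witness `K`. Tracing out
`XI'` cancels the next two, and the full average that remains gives `k`. -/
theorem partyL_mem_combSpan [Nonempty XI] [Nonempty XI'] [Nonempty XO] [Nonempty XO']
    (Y : Matrix (Party XI XI' XO XO') (Party XI XI' XO XO') ℂ) :
    partyL Y ∈ combSpan XI XI' XO XO' := by
  have hO : (Fintype.card XO : ℂ) ≠ 0 := by simp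
  have hO' : (Fintype.card XO' : ℂ) ≠ 0 := by simp
  have hI : (Fintype.card XI : ℂ) ≠ 0 := by simp
  have hI' : (Fintype.card XI' : ℂ) ≠ 0 := by simp
  refine mem_combSpan.2 ⟨fun i j => (Fintype.card XO' : ℂ)⁻¹ * ((∑ s, Y (i, s) (j, s))
    - (if i.2 = j.2 then (Fintype.card XI' : ℂ)⁻¹ *
        ∑ s : XI' × (XO × XO'), Y ((i.1, s.1), s.2) ((j.1, s.1), s.2) else 0)
    + (if i = j then (Fintype.card (XI × XI') : ℂ)⁻¹ * ∑ s, Y s s else 0)),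
    (Fintype.card XO' : ℂ)⁻¹ * ((Fintype.card XI : ℂ)⁻¹ * ∑ s, Y s s), ?_, ?_⟩
  · intro i j o' p'
    simp only [partyL, Matrix.of_apply, Finset.sum_add_distrib, Finset.sum_sub_distrib, if_true,
      Prod.mk.injEq, true_and, Finset.sum_const, Finset.card_univ, nsmul_eq_mul,
      Fintype.card_prod, Nat.cast_mul]
    split_ifs <;> simp_all <;> field_simp
  · rintro i j
    simp only [Finset.sum_add_distrib, Finset.sum_sub_distrib, ← Finset.mul_sum, if_true,
      Prod.mk.injEq, and_true, Finset.sum_const, Finset.card_univ, nsmul_eq_mul,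
      Fintype.card_prod, Nat.cast_mul, Fintype.sum_prod_type (α₁ := XI')]
    split_ifs <;> simp_all
    field_simp

omit [DecidableEq XI'] [DecidableEq XO] in
theorem trace_of_comb {Y : Matrix (Party XI XI' XO XO') (Party XI XI' XO XO') ℂ}
    {K : XI × XI' → XI × XI' → ℂ} {k : ℂ}
    (hK : ∀ i j o' p', ∑ o, Y (i, (o, o')) (j, (o, p')) = if o' = p' then K i j else 0)
    (hk : ∀ i j, ∑ i', K (i, i') (j, i') = if i = j then k else 0) :
    Y.trace = Fintype.card XI * (Fintype.card XO' * k) := by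
  have h2 (i : XI × XI') : ∑ s, Y (i, s) (i, s) = Fintype.card XO' * K i i := by
    rw [Fintype.sum_prod_type_right]
    simp [hK]
  have h3 (i : XI) : ∑ i', K (i, i') (i, i') = k := by simpa using hk i i
  simp only [Matrix.trace, Matrix.diag_apply]
  rw [Fintype.sum_prod_type, Fintype.sum_prod_type]
  simp [h2, ← Finset.mul_sum, h3]

/-- On a comb the correction terms cancel in pairs: averaging over `XO` already averages over `XO'`,
and averaging over `XI'`, `XO`, `XO'` already averages over `XI`. -/
theorem partyL_eq_self [Nonempty XI] [Nonempty XI'] [Nonempty XO] [Nonempty XO']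
    {Y : Matrix (Party XI XI' XO XO') (Party XI XI' XO XO') ℂ} (hY : Y ∈ combSpan XI XI' XO XO') :
    partyL Y = Y := by
  have hO : (Fintype.card XO : ℂ) ≠ 0 := by simp
  have hO' : (Fintype.card XO' : ℂ) ≠ 0 := by simp
  have hI : (Fintype.card XI : ℂ) ≠ 0 := by simp
  have hI' : (Fintype.card XI' : ℂ) ≠ 0 := by simp
  obtain ⟨K, k, hK, hk⟩ := mem_combSpan.1 hY
  have h2 (i j : XI × XI') : ∑ s, Y (i, s) (j, s) = Fintype.card XO' * K i j := by
    rw [Fintype.sum_prod_type_right]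
    simp [hK]
  have h3 (i j : XI) : ∑ s : XI' × (XO × XO'), Y ((i, s.1), s.2) ((j, s.1), s.2)
      = if i = j then Fintype.card XO' * k else 0 := by
    rw [Fintype.sum_prod_type]
    simp [h2, ← Finset.mul_sum, hk]
  have h4 : ∑ s, Y s s = Fintype.card XI * (Fintype.card XO' * k) := trace_of_comb hK hk
  ext ⟨⟨i, i'⟩, o, o'⟩ ⟨⟨j, j'⟩, p, p'⟩
  simp only [partyL, Matrix.of_apply, hK, h2, h3, h4, Prod.mk.injEq, Fintype.card_prod,
    Nat.cast_mul]
  split_ifs <;> simp_all <;> field_simp <;> ring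

end Combs

/-! ### Non-signalling adapters through their blocks. -/

section NonSignallingAdapters

variable {AI AI' AO AO' BI BI' BO BO' : Type u}
  [Fintype AI] [Fintype AI'] [Fintype AO] [Fintype AO']
  [Fintype BI] [Fintype BI'] [Fintype BO] [Fintype BO']
  [DecidableEq AI] [DecidableEq AI'] [DecidableEq AO] [DecidableEq AO']
  [DecidableEq BI] [DecidableEq BI'] [DecidableEq BO] [DecidableEq BO']

theorem fstBlock_projL_refl {R : Type*} (U : Matrix (Party AI AI' AO AO' × R)
    (Party AI AI' AO AO' × R) ℂ) (r r' : R) :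
    fstBlock (projL (Equiv.refl _) U) r r' = partyL (fstBlock U r r') := by
  ext x x'
  exact projL_apply _ _ _ _

theorem sndBlock_projL_prodComm {S : Type*} (U : Matrix (S × Party BI BI' BO BO')
    (S × Party BI BI' BO BO') ℂ) (s s' : S) :
    sndBlock (projL (Equiv.prodComm _ _) U) s s' = partyL (sndBlock U s s') := by
  ext x x'
  exact projL_apply _ _ _ _

/-- Applying `L_A` replaces Bob's blocks by linear combinations of Bob's blocks, so it preserves any
subspace containing them. This carries Bob's comb condition through the outer operator in `L_A (L_B
U)`. -/
theorem sndBlock_projL_refl_mem {R : Type*} (p : Submodule ℂ (Matrix R R ℂ))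
    {U : Matrix (Party AI AI' AO AO' × R) (Party AI AI' AO AO' × R) ℂ}
    (hU : ∀ s s', sndBlock U s s' ∈ p) (s s' : Party AI AI' AO AO') :
    sndBlock (projL (Equiv.refl _) U) s s' ∈ p := by
  -- Common shape of the four averaging terms of `L_A`.
  have hite (q : Prop) [Decidable q] (c : ℂ) {T : Type _} [Fintype T]
      (f f' : T → Party AI AI' AO AO') :
      (if q then c • ∑ t, sndBlock U (f t) (f' t) else 0) ∈ p := by
    split_ifs
    · exact p.smul_mem _ (p.sum_mem fun t _ => hU _ _)
    · exact p.zero_mem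
  have h := p.add_mem (p.sub_mem (p.add_mem (p.sub_mem (hU s s')
    (hite (s.2.1 = s'.2.1) (Fintype.card AO : ℂ)⁻¹
      (fun o => (s.1, (o, s.2.2))) (fun o => (s'.1, (o, s'.2.2)))))
    (hite (s.2 = s'.2) (Fintype.card (AO × AO') : ℂ)⁻¹ (fun t => (s.1, t)) (fun t => (s'.1, t))))
    (hite ((s.1.2, s.2) = (s'.1.2, s'.2)) (Fintype.card (AI' × (AO × AO')) : ℂ)⁻¹
      (fun t : AI' × (AO × AO') => ((s.1.1, t.1), t.2)) (fun t => ((s'.1.1, t.1), t.2))))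
    (hite (s = s') (Fintype.card (Party AI AI' AO AO') : ℂ)⁻¹ id id)
  convert h using 1
  ext r r'
  refine (projL_apply _ _ _ _).trans ?_
  simp only [partyL, Matrix.of_apply, Matrix.add_apply, Matrix.sub_apply, Matrix.ite_apply, fstBlock,
    Matrix.smul_apply, Matrix.sum_apply, sndBlock, smul_eq_mul, Matrix.zero_apply]
  rfl

/-- Linear characterization of non-signalling adapters through their one-party blocks. -/
theorem mem_nonSignallingAdapters_iff
    [Nonempty AI] [Nonempty AI'] [Nonempty AO] [Nonempty AO']
    [Nonempty BI] [Nonempty BI'] [Nonempty BO] [Nonempty BO']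
    {U : Matrix (Party AI AI' AO AO' × Party BI BI' BO BO')
      (Party AI AI' AO AO' × Party BI BI' BO BO') ℂ} :
    U ∈ nonSignallingAdapters AI AI' AO AO' BI BI' BO BO' ↔ U.PosSemidef ∧
      (∀ r r', fstBlock U r r' ∈ combSpan AI AI' AO AO') ∧
      (∀ s s', sndBlock U s s' ∈ combSpan BI BI' BO BO') ∧
      U.trace = (Fintype.card AI : ℂ) * Fintype.card AO' * Fintype.card BI * Fintype.card BO' := by
  refine and_congr_right fun _ => Iff.trans (and_congr_left fun _ => ?_) and_assoc
  constructor
  · intro h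
    constructor
    · intro r r'
      rw [h, fstBlock_projL_refl]
      exact partyL_mem_combSpan _
    · rw [h]
      refine sndBlock_projL_refl_mem _ fun s s' => ?_
      rw [sndBlock_projL_prodComm]
      exact partyL_mem_combSpan _
  · rintro ⟨hA, hB⟩
    have h1 : projL (Equiv.prodComm (Party AI AI' AO AO') (Party BI BI' BO BO')) U = U := by
      ext ⟨s, r⟩ ⟨s', r'⟩
      have h := sndBlock_projL_prodComm U s s'
      rw [partyL_eq_self (hB s s')] at h
      exact congrFun₂ h r r'
    rw [h1]
    ext ⟨s, r⟩ ⟨s', r'⟩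
    have h := fstBlock_projL_refl U r r'
    rw [partyL_eq_self (hA r r')] at h
    exact (congrFun₂ h s s').symm

end NonSignallingAdapters

/-! ### The action of a comb on a channel for one party. -/

section PartyAction

theorem trace_of_channel {P V : Type*} [Fintype P] [Fintype V] [DecidableEq P]
    {D : Matrix (P × V) (P × V) ℂ} {d : ℂ}
    (hD : ∀ p p', ∑ v, D (p, v) (p', v) = if p = p' then d else 0) :
    D.trace = Fintype.card P * d := by
  simp [Matrix.trace, Fintype.sum_prod_type, hD]

variable {XI XI' XO XO' XIbar XObar : Type*} [Fintype XI] [Fintype XI'] [Fintype XO] [Fintype XO']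
  [Fintype XIbar] [Fintype XObar] [DecidableEq XI] [DecidableEq XI'] [DecidableEq XO]
  [DecidableEq XO'] [DecidableEq XIbar] [DecidableEq XObar]

/-- The link product over the primed spaces, for a single party. -/
def partyAction (Y : Matrix (Party XI XI' XO XO') (Party XI XI' XO XO') ℂ)
    (C : Matrix (Party XI' XIbar XO' XObar) (Party XI' XIbar XO' XObar) ℂ) :
    Matrix (Party XI XIbar XO XObar) (Party XI XIbar XO XObar) ℂ :=
  Matrix.of fun x x' => ∑ y : XI' × XO', ∑ y' : XI' × XO',
    Y ((x.1.1, y.1), (x.2.1, y.2)) ((x'.1.1, y'.1), (x'.2.1, y'.2)) *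
      C ((y.1, x.1.2), (y.2, x.2.2)) ((y'.1, x'.1.2), (y'.2, x'.2.2))

omit [DecidableEq XO] [DecidableEq XObar] in
/-- One-slot combs map channels to channels, and the normalizations multiply. -/
theorem partyAction_mem_channelSpan [Nonempty XI'] [Nonempty XO']
    {Y : Matrix (Party XI XI' XO XO') (Party XI XI' XO XO') ℂ}
    {C : Matrix (Party XI' XIbar XO' XObar) (Party XI' XIbar XO' XObar) ℂ}
    (hY : Y ∈ combSpan XI XI' XO XO') (hC : C ∈ channelSpan (XI' × XIbar) (XO' × XObar)) :
    partyAction Y C ∈ channelSpan (XI × XIbar) (XO × XObar) ∧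
      (partyAction Y C).trace = (Fintype.card XI' * Fintype.card XO' : ℂ)⁻¹ * (Y.trace * C.trace) := by
  obtain ⟨K, k, hK, hk⟩ := mem_combSpan.1 hY
  obtain ⟨c, hc⟩ := mem_channelSpan.1 hC
  have key : ∀ p p', ∑ v, partyAction Y C (p, v) (p', v) = if p = p' then k * c else 0 := by
    rintro ⟨i, x⟩ ⟨j, x'⟩
    -- The first comb condition turns `Y` into `K` and sets the two `XO'` indices of `C` equal, so
    -- that `C` gets traced over its whole output. The channel condition then sets `i' = j'`, which
    -- is the partial trace of `K` in the second comb condition.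
    have h1 (xo : XObar) : ∑ o, partyAction Y C ((i, x), (o, xo)) ((j, x'), (o, xo)) =
        ∑ i', ∑ j', ∑ o', K (i, i') (j, j') * C ((i', x), (o', xo)) ((j', x'), (o', xo)) := by
      simp only [partyAction, Matrix.of_apply]
      rw [Finset.sum_comm]
      simp only [Finset.sum_comm (s := (Finset.univ : Finset XO)), ← Finset.sum_mul, hK]
      simp only [Fintype.sum_prod_type, ite_mul, zero_mul, Finset.sum_ite_eq, Finset.mem_univ,
        if_true]
      exact Finset.sum_congr rfl fun _ _ => Finset.sum_comm
    have h2 (i' j' : XI') : ∑ xo, ∑ o', K (i, i') (j, j') *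
        C ((i', x), (o', xo)) ((j', x'), (o', xo)) =
        if i' = j' then if x = x' then K (i, i') (j, j') * c else 0 else 0 := by
      have h := hc (i', x) (j', x')
      rw [Fintype.sum_prod_type_right] at h
      simp only [← Finset.mul_sum, h, Prod.mk.injEq, ite_and]
      split_ifs <;> simp
    rw [Fintype.sum_prod_type_right]
    simp only [h1]
    rw [Finset.sum_comm]
    refine (Finset.sum_congr rfl fun i' _ => Finset.sum_comm.trans
      (Finset.sum_congr rfl fun j' _ => h2 i' j')).trans ?_
    simp only [Finset.sum_ite_eq, Finset.mem_univ, if_true, Prod.mk.injEq]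
    by_cases hx : x = x' <;> simp [hx, ← Finset.sum_mul, hk]
  refine ⟨⟨_, key⟩, ?_⟩
  have hO' : (Fintype.card XO' : ℂ) ≠ 0 := by simp
  have hI' : (Fintype.card XI' : ℂ) ≠ 0 := by simp
  rw [trace_of_channel key, trace_of_channel hc, trace_of_comb hK hk]
  simp only [Fintype.card_prod, Nat.cast_mul]
  field_simp

end PartyAction

/-! ### Entries and positivity of the link product. -/

section Link

variable {X Y Z : Type*} [Fintype X] [Fintype Y] [Fintype Z] [DecidableEq X] [DecidableEq Z]

/-- Because of the partial transpose, `F` and `L` carry the same row index `y` and the same column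
index `y'`. -/
theorem link_apply (F : Matrix (X × Y) (X × Y) ℂ) (L : Matrix (Y × Z) (Y × Z) ℂ) (p p' : X × Z) :
    link F L p p' = ∑ y, ∑ y', F (p.1, y) (p'.1, y') * L (y, p.2) (y', p'.2) := by
  simp [link, traceFst, transposeFst, Matrix.mul_apply, Fintype.sum_prod_type, Matrix.one_apply,
    Finset.sum_ite_irrel]

/-- The link product is a congruence of a principal submatrix of `F ⊗ₖ L`: `f` keeps the indices
where the two copies of `Y` agree, and `V` sums over the common value. -/
theorem posSemidef_link [DecidableEq Y] {F : Matrix (X × Y) (X × Y) ℂ}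
    {L : Matrix (Y × Z) (Y × Z) ℂ}
    (hF : F.PosSemidef) (hL : L.PosSemidef) : (link F L).PosSemidef := by
  let V : Matrix (X × Z) (Y × (X × Z)) ℂ := Matrix.of fun p q => if p = q.2 then 1 else 0
  let f : Y × (X × Z) → (X × Y) × (Y × Z) := fun q => ((q.2.1, q.1), (q.1, q.2.2))
  have h := ((hF.kronecker hL).submatrix f).mul_mul_conjTranspose_same V
  have e : link F L = V * (F ⊗ₖ L).submatrix f f * V.conjTranspose := by
    ext p p'
    simp only [link_apply, Matrix.mul_apply, Matrix.conjTranspose_apply, V, f, Matrix.of_apply,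
      Fintype.sum_prod_type_right (α₂ := X × Z)]
    simp
    exact Finset.sum_comm
  rw [e]
  exact h

end Link

/-! ### Non-signalling adapters are completely admissible. -/

section AdapterAction

variable {AI AI' AO AO' BI BI' BO BO' : Type u}
  [Fintype AI] [Fintype AI'] [Fintype AO] [Fintype AO']
  [Fintype BI] [Fintype BI'] [Fintype BO] [Fintype BO']
  [DecidableEq AI] [DecidableEq AO] [DecidableEq BI] [DecidableEq BO]
  {AIbar AObar BIbar BObar : Type*}
  [Fintype AIbar] [Fintype AObar] [Fintype BIbar] [Fintype BObar]
  [DecidableEq AIbar] [DecidableEq AObar] [DecidableEq BIbar] [DecidableEq BObar]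
  (U : Matrix (Party AI AI' AO AO' × Party BI BI' BO BO')
    (Party AI AI' AO AO' × Party BI BI' BO BO') ℂ)
  (M : Matrix (Party AI' AIbar AO' AObar × Party BI' BIbar BO' BObar)
    (Party AI' AIbar AO' AObar × Party BI' BIbar BO' BObar) ℂ)

theorem posSemidef_adapterAction [DecidableEq AI'] [DecidableEq AO'] [DecidableEq BI']
    [DecidableEq BO']
    (hU : Matrix.PosSemidef U) (hM : Matrix.PosSemidef M) : (adapterAction U M).PosSemidef := by
  have h1 := hU.submatrix (splitLegs AI AI' AO AO' BI BI' BO BO').symm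
  have h2 := hM.submatrix (splitLegs AI' AIbar AO' AObar BI' BIbar BO' BObar).symm
  exact (posSemidef_link h1 h2).submatrix (splitLegs AI AIbar AO AObar BI BIbar BO BObar)

theorem fstBlock_adapterAction (r r' : Party BI BIbar BO BObar) :
    fstBlock (adapterAction U M) r r' = ∑ z : BI' × BO', ∑ z' : BI' × BO', partyAction
      (fstBlock U ((r.1.1, z.1), (r.2.1, z.2)) ((r'.1.1, z'.1), (r'.2.1, z'.2)))
      (fstBlock M ((z.1, r.1.2), (z.2, r.2.2)) ((z'.1, r'.1.2), (z'.2, r'.2.2))) := by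
  ext s s'
  simp only [fstBlock, Matrix.of_apply, adapterAction, Matrix.reindex_apply,
    Matrix.submatrix_apply, link_apply, partyAction, Matrix.sum_apply]
  rw [Fintype.sum_prod_type_right]
  refine Finset.sum_congr rfl fun z _ => ?_
  simp only [Fintype.sum_prod_type_right (α₂ := BI' × BO')]
  rw [Finset.sum_comm]
  rfl

theorem sndBlock_adapterAction (s s' : Party AI AIbar AO AObar) :
    sndBlock (adapterAction U M) s s' = ∑ z : AI' × AO', ∑ z' : AI' × AO', partyAction
      (sndBlock U ((s.1.1, z.1), (s.2.1, z.2)) ((s'.1.1, z'.1), (s'.2.1, z'.2)))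
      (sndBlock M ((z.1, s.1.2), (z.2, s.2.2)) ((z'.1, s'.1.2), (z'.2, s'.2.2))) := by
  ext r r'
  simp only [sndBlock, Matrix.of_apply, adapterAction, Matrix.reindex_apply,
    Matrix.submatrix_apply, link_apply, partyAction, Matrix.sum_apply]
  rw [Fintype.sum_prod_type]
  refine Finset.sum_congr rfl fun z _ => ?_
  simp only [Fintype.sum_prod_type (α₁ := AI' × AO')]
  rw [Finset.sum_comm]
  rfl

variable {U M} [DecidableEq AI'] [DecidableEq AO'] [DecidableEq BI'] [DecidableEq BO']
  [Nonempty AI'] [Nonempty AO'] [Nonempty BI'] [Nonempty BO']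

/-- One-party multiplicativity is used twice: on Alice's blocks, and then on Bob's matrices left
after tracing out Alice. -/
theorem trace_adapterAction
    (hUA : ∀ r r', fstBlock U r r' ∈ combSpan AI AI' AO AO')
    (hUB : ∀ s s', sndBlock U s s' ∈ combSpan BI BI' BO BO')
    (hMA : ∀ r r', fstBlock M r r' ∈ channelSpan (AI' × AIbar) (AO' × AObar))
    (hMB : ∀ s s', sndBlock M s s' ∈ channelSpan (BI' × BIbar) (BO' × BObar)) :
    (adapterAction U M).trace = (Fintype.card AI' * Fintype.card AO' : ℂ)⁻¹ *
      ((Fintype.card BI' * Fintype.card BO' : ℂ)⁻¹ * (U.trace * M.trace)) := by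
  -- The sums of diagonal blocks are the partial traces of `U` and `M` over Alice.
  have h1 := (partyAction_mem_channelSpan
    (Submodule.sum_mem (t := Finset.univ) _ fun s _ => hUB s s)
    (Submodule.sum_mem (t := Finset.univ) _ fun s _ => hMB s s)).2
  rw [Matrix.trace_sum, Matrix.trace_sum, ← trace_eq_sum_trace_sndBlock,
    ← trace_eq_sum_trace_sndBlock] at h1
  rw [← h1, trace_eq_sum_trace_fstBlock]
  simp only [fstBlock_adapterAction, Matrix.trace_sum,
    (partyAction_mem_channelSpan (hUA _ _) (hMA _ _)).2, ← Finset.mul_sum]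
  congr 1
  simp only [Matrix.trace, Matrix.diag_apply, partyAction, Matrix.of_apply, Matrix.sum_apply,
    fstBlock, sndBlock]

theorem nonSignallingAdapters_subset (AI AI' AO AO' BI BI' BO BO' : Type u)
    [Fintype AI] [Fintype AI'] [Fintype AO] [Fintype AO']
    [Fintype BI] [Fintype BI'] [Fintype BO] [Fintype BO']
    [DecidableEq AI] [DecidableEq AI'] [DecidableEq AO] [DecidableEq AO']
    [DecidableEq BI] [DecidableEq BI'] [DecidableEq BO] [DecidableEq BO']
    [Nonempty AI] [Nonempty AI'] [Nonempty AO] [Nonempty AO']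
    [Nonempty BI] [Nonempty BI'] [Nonempty BO] [Nonempty BO'] :
    nonSignallingAdapters AI AI' AO AO' BI BI' BO BO' ⊆
      completelyAdmissibleAdapters AI AI' AO AO' BI BI' BO BO' := by
  intro U hU
  obtain ⟨hpos, hUA, hUB, htr⟩ := mem_nonSignallingAdapters_iff.1 hU
  refine ⟨hpos, ?_⟩
  intro AIbar AObar BIbar BObar _ _ _ _ _ _ _ _ _ _ _ _ M hM
  obtain ⟨hMpos, hMA, hMB, hMtr⟩ := isNonSignallingChannel_iff.1 hM
  refine isNonSignallingChannel_iff.2 ⟨posSemidef_adapterAction U M hpos hMpos, fun r r' => ?_,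
    fun s s' => ?_, ?_⟩
  · rw [fstBlock_adapterAction]
    exact Submodule.sum_mem _ fun z _ => Submodule.sum_mem _ fun z' _ =>
      (partyAction_mem_channelSpan (hUA _ _) (hMA _ _)).1
  · rw [sndBlock_adapterAction]
    exact Submodule.sum_mem _ fun z _ => Submodule.sum_mem _ fun z' _ =>
      (partyAction_mem_channelSpan (hUB _ _) (hMB _ _)).1
  · rw [trace_adapterAction hUA hUB hMA hMB, htr, hMtr]
    have h1 : (Fintype.card AI' : ℂ) ≠ 0 := by simp
    have h2 : (Fintype.card AO' : ℂ) ≠ 0 := by simp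
    have h3 : (Fintype.card BI' : ℂ) ≠ 0 := by simp
    have h4 : (Fintype.card BO' : ℂ) ≠ 0 := by simp
    simp only [Fintype.card_prod, Nat.cast_mul]
    field_simp

end AdapterAction

/-! ### Test channels that detect combs. -/

section TestChannels

variable {XI XI' XO XO' : Type*} [Fintype XI] [Fintype XI'] [Fintype XO] [Fintype XO']
  [DecidableEq XI] [DecidableEq XI'] [DecidableEq XO] [DecidableEq XO']

theorem isNonSignallingChannel_kronecker {P Q V W : Type*} [Fintype P] [Fintype Q] [Fintype V]
    [Fintype W] [DecidableEq P] [DecidableEq Q] [DecidableEq V] [DecidableEq W]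
    [Nonempty P] [Nonempty Q] {C : Matrix (P × V) (P × V) ℂ} {D : Matrix (Q × W) (Q × W) ℂ}
    (hC : IsChannel C) (hD : IsChannel D) : IsNonSignallingChannel (C ⊗ₖ D) := by
  refine isNonSignallingChannel_iff.2 ⟨hC.1.kronecker hD.1, fun r r' => ?_, fun s s' => ?_, ?_⟩
  · convert (channelSpan P V).smul_mem (D r r') hC.mem_channelSpan using 1
    ext s s'
    simp [fstBlock, mul_comm]
  · exact (channelSpan Q W).smul_mem (C s s') hD.mem_channelSpan
  · rw [Matrix.trace_kronecker, trace_of_channel (d := 1) fun p p' => congrFun₂ hC.2 p p',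
      trace_of_channel (d := 1) fun p p' => congrFun₂ hD.2 p p', mul_one, mul_one]

/-- The Choi matrix of the identity channel from `X_I' X_O'` to `X_O' X_I'`. -/
def crossChannel (XI' XO' : Type*) [DecidableEq XI'] [DecidableEq XO'] :
    Matrix (Party XI' XO' XO' XI') (Party XI' XO' XO' XI') ℂ :=
  Matrix.of fun x x' => if x.2.swap = x.1 then if x'.2.swap = x'.1 then 1 else 0 else 0

theorem isChannel_crossChannel : IsChannel (crossChannel XI' XO') := by
  constructor
  · have h := Matrix.posSemidef_vecMulVec_self_star
      (fun x : Party XI' XO' XO' XI' => if x.2.swap = x.1 then (1 : ℂ) else 0)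
    convert h using 1
    ext x x'
    simp [crossChannel, Matrix.vecMulVec_apply, apply_ite (starRingEnd ℂ), ← ite_and, and_comm]
  · ext ⟨i, o⟩ ⟨j, p⟩
    simp [crossChannel, traceSnd, Matrix.one_apply, Fintype.sum_prod_type, ite_and]

/-- Linking with the crossed identity merely relabels indices: the contracted inner legs reappear,
swapped, as outer ones. -/
theorem sum_mul_crossChannel (f : XI' × XO' → XI' × XO' → ℂ) (x x' : XO' × XI') :
    ∑ z : XI' × XO', ∑ z' : XI' × XO',
      f z z' * crossChannel XI' XO' ((z.1, x.1), (z.2, x.2)) ((z'.1, x'.1), (z'.2, x'.2)) =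
      f x.swap x'.swap := by
  rw [Finset.sum_eq_single x.swap, Finset.sum_eq_single x'.swap]
  · simp [crossChannel, Prod.swap]
  · rintro ⟨a, b⟩ - h
    simp [crossChannel]
    grind
  · simp
  · rintro ⟨a, b⟩ - h
    simp [crossChannel]
    grind
  · simp

/-- The unnormalized maximally entangled vector. -/
def diagonalVector (X : Type*) [DecidableEq X] : X × X → ℂ := fun x => if x.1 = x.2 then 1 else 0

/-- The normalized maximally entangled projection. -/
noncomputable def bellProjection (X : Type*) [Fintype X] [DecidableEq X] :
    Matrix (X × X) (X × X) ℂ :=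
  (Fintype.card X : ℂ)⁻¹ • Matrix.vecMulVec (diagonalVector X) (star (diagonalVector X))

theorem bellProjection_apply (x x' : XI' × XI') : bellProjection XI' x x' =
    (Fintype.card XI' : ℂ)⁻¹ * if x.1 = x.2 then if x'.1 = x'.2 then 1 else 0 else 0 := by
  simp [bellProjection, diagonalVector, Matrix.vecMulVec_apply, apply_ite (starRingEnd ℂ), ← ite_and, and_comm]

theorem posSemidef_bellProjection : (bellProjection XI').PosSemidef :=
  (Matrix.posSemidef_vecMulVec_self_star _).smul (by positivity)

/-- The Bell projection `P` is Hermitian and idempotent, so `1 - P = (1 - P)ᴴ * (1 - P)`. -/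
theorem posSemidef_one_sub_bellProjection [Nonempty XI'] :
    (1 - bellProjection XI').PosSemidef := by
  have hc : (Fintype.card XI' : ℂ) ≠ 0 := by simp
  have h1 : bellProjection XI' * bellProjection XI' = bellProjection XI' := by
    ext x x'
    simp only [Matrix.mul_apply, bellProjection_apply, Fintype.sum_prod_type]
    split_ifs <;> simp
  have h2 : (1 - bellProjection XI').conjTranspose = 1 - bellProjection XI' := by
    rw [Matrix.conjTranspose_sub, Matrix.conjTranspose_one, posSemidef_bellProjection.1.eq]
  have h3 := Matrix.posSemidef_conjTranspose_mul_self (1 - bellProjection XI')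
  rwa [h2, sub_mul, mul_sub, mul_sub, h1, one_mul, mul_one, one_mul, sub_self, sub_zero] at h3

/-- The Choi matrix of the channel `X_I' ⊗ (X_I' ⊗ X_O') → X_O'` that measures whether its first
two inputs are maximally entangled, and then outputs its third input on success and the maximally
mixed state on failure. -/
noncomputable def bellChannel (XI' XO' : Type*) [Fintype XI'] [Fintype XO'] [DecidableEq XI']
    [DecidableEq XO'] : Matrix (Party XI' (XI' × XO') XO' PUnit.{u + 1})
      (Party XI' (XI' × XO') XO' PUnit.{u + 1}) ℂ :=
  (bellProjection XI' ⊗ₖ Matrix.vecMulVec (diagonalVector XO') (star (diagonalVector XO')) +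
    (1 - bellProjection XI') ⊗ₖ ((Fintype.card XO' : ℂ)⁻¹ • (1 : Matrix (XO' × XO') (XO' × XO') ℂ))
      ).submatrix (fun x : Party XI' (XI' × XO') XO' PUnit => ((x.1.1, x.1.2.1), (x.1.2.2, x.2.1)))
        (fun x : Party XI' (XI' × XO') XO' PUnit => ((x.1.1, x.1.2.1), (x.1.2.2, x.2.1)))

theorem isChannel_bellChannel [Nonempty XI'] [Nonempty XO'] :
    IsChannel (bellChannel.{u} XI' XO') := by
  have hc : (Fintype.card XO' : ℂ) ≠ 0 := by simp
  constructor
  · refine Matrix.PosSemidef.submatrix (Matrix.PosSemidef.add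
      (posSemidef_bellProjection.kronecker (Matrix.posSemidef_vecMulVec_self_star _))
      (posSemidef_one_sub_bellProjection.kronecker (Matrix.PosSemidef.one.smul (by positivity)))) _
  · ext ⟨i, x, y⟩ ⟨j, x', y'⟩
    simp [bellChannel, diagonalVector, traceSnd, Matrix.one_apply, Fintype.sum_prod_type, ite_and,
      Matrix.vecMulVec_apply, apply_ite (starRingEnd ℂ), Finset.sum_add_distrib]
    split_ifs <;> simp_all <;> field_simp <;> ring

omit [Fintype XI] [Fintype XO] [DecidableEq XI] [DecidableEq XO] in
theorem partyAction_crossChannel (Y : Matrix (Party XI XI' XO XO') (Party XI XI' XO XO') ℂ)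
    (x x' : Party XI XO' XO XI') :
    partyAction Y (crossChannel XI' XO') x x' =
      Y ((x.1.1, x.2.2), (x.2.1, x.1.2)) ((x'.1.1, x'.2.2), (x'.2.1, x'.1.2)) :=
  sum_mul_crossChannel (fun y y' => Y ((x.1.1, y.1), (x.2.1, y.2)) ((x'.1.1, y'.1), (x'.2.1, y'.2)))
    (x.1.2, x.2.2) (x'.1.2, x'.2.2)

omit [Fintype XI] [DecidableEq XO] in
/-- A matrix is in the span of the one-slot combs as soon as it maps two test channels to
multiples of channels. -/
theorem mem_combSpan_of_partyAction [Nonempty XI'] [Nonempty XO']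
    {Y : Matrix (Party XI XI' XO XO') (Party XI XI' XO XO') ℂ}
    (h1 : partyAction Y (crossChannel XI' XO') ∈ channelSpan (XI × XO') (XO × XI'))
    (h2 : partyAction Y (bellChannel.{u} XI' XO') ∈
      channelSpan (XI × (XI' × XO')) (XO × PUnit.{u + 1})) :
    Y ∈ combSpan XI XI' XO XO' := by
  have hc : (Fintype.card XI' : ℂ) ≠ 0 := by simp
  obtain ⟨c, hc1⟩ := mem_channelSpan.1 h1
  obtain ⟨d, hd⟩ := mem_channelSpan.1 h2
  obtain ⟨o₀⟩ := ‹Nonempty XO'›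
  have key : ∃ K : XI × XI' → XI × XI' → ℂ, ∀ i j o' p',
      ∑ o, Y (i, (o, o')) (j, (o, p')) = if o' = p' then K i j else 0 := by
    -- The success branch of `bellChannel` contributes the wanted sum over `o`, divided by the
    -- dimension of `XI'`. The failure branch and the right-hand side of `hd` both carry the delta
    -- of `o'` and `p'`, so solving for the sum yields this `K`.
    refine ⟨fun i j => Fintype.card XI' * ((if i = j then d else 0) - ∑ o, ∑ y : XI' × XO',
      ∑ y' : XI' × XO',
      Y ((i.1, y.1), (o, y.2)) ((j.1, y'.1), (o, y'.2)) *
        ((1 - bellProjection XI') (y.1, i.2) (y'.1, j.2) * if y.2 = y'.2 then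
          (Fintype.card XO' : ℂ)⁻¹ else 0)), ?_⟩
    rintro ⟨i, x⟩ ⟨j, x'⟩ o' p'
    have h := hd (i, (x, o')) (j, (x', p'))
    have hb (y y' : XI' × XO') : bellChannel.{u} XI' XO' ((y.1, (x, o')), (y.2, PUnit.unit))
        ((y'.1, (x', p')), (y'.2, PUnit.unit)) =
        -- The success branch teleports: it identifies the inner legs with the auxiliary input.
        (if y = (x, o') then if y' = (x', p') then (Fintype.card XI' : ℂ)⁻¹ else 0 else 0) +
        if o' = p' then (1 - bellProjection XI') (y.1, x) (y'.1, x') *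
          (if y.2 = y'.2 then (Fintype.card XO' : ℂ)⁻¹ else 0) else 0 := by
      simp only [bellChannel, diagonalVector, Matrix.submatrix_apply, Matrix.add_apply, Matrix.kroneckerMap_apply,
        bellProjection_apply, Matrix.vecMulVec_apply, Matrix.smul_apply, Matrix.one_apply]
      congr 1
      · obtain ⟨a, b⟩ := y
        obtain ⟨a', b'⟩ := y'
        by_cases ha : a = x <;> by_cases hb : b = o' <;> by_cases ha' : a' = x' <;>
          by_cases hb' : b' = p' <;> simp [diagonalVector, ha, hb, ha', hb', Ne.symm]
      · by_cases ho : o' = p' <;> simp [ho]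
    simp only [partyAction, Matrix.of_apply, Fintype.sum_prod_type (α₂ := PUnit), hb,
      Finset.univ_unique, Finset.sum_singleton, mul_add, Finset.sum_add_distrib] at h
    simp only [mul_ite, mul_zero, Finset.sum_ite_irrel, Finset.sum_const_zero, Finset.sum_ite_eq',
      Finset.mem_univ, if_true, ← Finset.sum_mul] at h
    split_ifs with hp
    · simp only [hp, if_true, Prod.mk.injEq, and_true] at h
      simp only [Prod.mk.injEq, mul_ite, mul_zero, ← h, hp]
      field_simp
      ring
    · simpa [hp] using h
  obtain ⟨K, hK⟩ := key
  refine mem_combSpan.2 ⟨K, c, hK, fun i j => ?_⟩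
  -- In the `crossChannel` test `XO'` is an outer input; any diagonal value `o₀` of it reduces the
  -- output trace to the partial trace of `K`.
  have h := hc1 (i, o₀) (j, o₀)
  simp only [partyAction_crossChannel] at h
  rw [Fintype.sum_prod_type_right] at h
  simpa [hK] using h

end TestChannels

/-! ### Completely admissible adapters are non-signalling. -/

section CompletelyAdmissible

variable {AI AI' AO AO' BI BI' BO BO' : Type u}
  [Fintype AI] [Fintype AI'] [Fintype AO] [Fintype AO']
  [Fintype BI] [Fintype BI'] [Fintype BO] [Fintype BO']
  [DecidableEq AI] [DecidableEq AO] [DecidableEq BI] [DecidableEq BO]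

/-- With `crossChannel` on Bob's side the sum over his inner legs collapses to one term, so a single
block of `U` is tested against an arbitrary `C`. -/
theorem fstBlock_adapterAction_kronecker_crossChannel [DecidableEq BI'] [DecidableEq BO']
    {AIbar AObar : Type*} [Fintype AIbar] [Fintype AObar] [DecidableEq AIbar] [DecidableEq AObar]
    (U : Matrix (Party AI AI' AO AO' × Party BI BI' BO BO')
      (Party AI AI' AO AO' × Party BI BI' BO BO') ℂ)
    (C : Matrix (Party AI' AIbar AO' AObar) (Party AI' AIbar AO' AObar) ℂ)
    (r r' : Party BI BI' BO BO') :
    fstBlock (adapterAction U (C ⊗ₖ crossChannel BI' BO'))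
      ((r.1.1, r.2.2), (r.2.1, r.1.2)) ((r'.1.1, r'.2.2), (r'.2.1, r'.1.2)) =
      partyAction (fstBlock U r r') C := by
  rw [fstBlock_adapterAction]
  ext s s'
  refine Eq.trans ?_ (sum_mul_crossChannel (fun z z' => partyAction
    (fstBlock U ((r.1.1, z.1), (r.2.1, z.2)) ((r'.1.1, z'.1), (r'.2.1, z'.2))) C s s')
    (r.2.2, r.1.2) (r'.2.2, r'.1.2))
  simp only [Matrix.sum_apply, partyAction, Matrix.of_apply, fstBlock, Matrix.kroneckerMap_apply,
    Finset.sum_mul, mul_assoc]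

theorem sndBlock_adapterAction_crossChannel_kronecker [DecidableEq AI'] [DecidableEq AO']
    {BIbar BObar : Type*} [Fintype BIbar] [Fintype BObar] [DecidableEq BIbar] [DecidableEq BObar]
    (U : Matrix (Party AI AI' AO AO' × Party BI BI' BO BO')
      (Party AI AI' AO AO' × Party BI BI' BO BO') ℂ)
    (C : Matrix (Party BI' BIbar BO' BObar) (Party BI' BIbar BO' BObar) ℂ)
    (s s' : Party AI AI' AO AO') :
    sndBlock (adapterAction U (crossChannel AI' AO' ⊗ₖ C))
      ((s.1.1, s.2.2), (s.2.1, s.1.2)) ((s'.1.1, s'.2.2), (s'.2.1, s'.1.2)) =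
      partyAction (sndBlock U s s') C := by
  rw [sndBlock_adapterAction]
  ext r r'
  refine Eq.trans ?_ (sum_mul_crossChannel (fun z z' => partyAction
    (sndBlock U ((s.1.1, z.1), (s.2.1, z.2)) ((s'.1.1, z'.1), (s'.2.1, z'.2))) C r r')
    (s.2.2, s.1.2) (s'.2.2, s'.1.2))
  simp only [Matrix.sum_apply, partyAction, Matrix.of_apply, sndBlock, Matrix.kroneckerMap_apply,
    Finset.sum_mul]
  refine Finset.sum_congr rfl fun z _ => Finset.sum_congr rfl fun z' _ =>
    Finset.sum_congr rfl fun y _ => Finset.sum_congr rfl fun y' _ => ?_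
  rw [mul_assoc, mul_comm (crossChannel AI' AO' _ _)]

theorem completelyAdmissibleAdapters_subset (AI AI' AO AO' BI BI' BO BO' : Type u)
    [Fintype AI] [Fintype AI'] [Fintype AO] [Fintype AO']
    [Fintype BI] [Fintype BI'] [Fintype BO] [Fintype BO']
    [DecidableEq AI] [DecidableEq AI'] [DecidableEq AO] [DecidableEq AO']
    [DecidableEq BI] [DecidableEq BI'] [DecidableEq BO] [DecidableEq BO']
    [Nonempty AI] [Nonempty AI'] [Nonempty AO] [Nonempty AO']
    [Nonempty BI] [Nonempty BI'] [Nonempty BO] [Nonempty BO'] :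
    completelyAdmissibleAdapters AI AI' AO AO' BI BI' BO BO' ⊆
      nonSignallingAdapters AI AI' AO AO' BI BI' BO BO' := by
  rintro U ⟨hpos, hU⟩
  have hcc := isNonSignallingChannel_iff.1 (hU AO' AI' BO' BI' _
    (isNonSignallingChannel_kronecker isChannel_crossChannel isChannel_crossChannel))
  have hbc := isNonSignallingChannel_iff.1 (hU (AI' × AO') PUnit.{u + 1} BO' BI' _
    (isNonSignallingChannel_kronecker isChannel_bellChannel isChannel_crossChannel))
  have hcb := isNonSignallingChannel_iff.1 (hU AO' AI' (BI' × BO') PUnit.{u + 1} _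
    (isNonSignallingChannel_kronecker isChannel_crossChannel isChannel_bellChannel))
  refine mem_nonSignallingAdapters_iff.2 ⟨hpos, fun r r' => ?_, fun s s' => ?_, ?_⟩
  · refine mem_combSpan_of_partyAction.{u} ?_ ?_
    · rw [← fstBlock_adapterAction_kronecker_crossChannel]
      exact hcc.2.1 _ _
    · rw [← fstBlock_adapterAction_kronecker_crossChannel]
      exact hbc.2.1 _ _
  · refine mem_combSpan_of_partyAction.{u} ?_ ?_
    · rw [← sndBlock_adapterAction_crossChannel_kronecker]
      exact hcc.2.2.1 _ _
    · rw [← sndBlock_adapterAction_crossChannel_kronecker]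
      exact hcb.2.2.1 _ _
  · have h := hcc.2.2.2
    simp only [Fintype.card_prod, Nat.cast_mul, ← mul_assoc] at h
    rw [← h, trace_eq_sum_trace_fstBlock, trace_eq_sum_trace_fstBlock]
    -- With `crossChannel` on both sides the action is `U` with its legs permuted, so the traces
    -- agree; `e` is the permutation for one party.
    let e (X X' Y Y' : Type u) : Party X X' Y Y' ≃ Party X Y' Y X' :=
      ⟨fun r => ((r.1.1, r.2.2), (r.2.1, r.1.2)), fun r => ((r.1.1, r.2.2), (r.2.1, r.1.2)),
        fun _ => rfl, fun _ => rfl⟩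
    refine Fintype.sum_equiv (e BI BI' BO BO') _ _ fun r => ?_
    refine Eq.trans ?_ (congrArg Matrix.trace
      (fstBlock_adapterAction_kronecker_crossChannel U (crossChannel AI' AO') r r).symm)
    refine Fintype.sum_equiv (e AI AI' AO AO') _ _ fun s => ?_
    exact (partyAction_crossChannel (fstBlock U r r) (e AI AI' AO AO' s) (e AI AI' AO AO' s)).symm

end CompletelyAdmissible
end NSAdapter

theorem mainTheorem2 (AI AI' AO AO' BI BI' BO BO' : Type u)
    [Fintype AI] [Fintype AI'] [Fintype AO] [Fintype AO']
    [Fintype BI] [Fintype BI'] [Fintype BO] [Fintype BO']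
    [DecidableEq AI] [DecidableEq AI'] [DecidableEq AO] [DecidableEq AO']
    [DecidableEq BI] [DecidableEq BI'] [DecidableEq BO] [DecidableEq BO']
    [Nonempty AI] [Nonempty AI'] [Nonempty AO] [Nonempty AO']
    [Nonempty BI] [Nonempty BI'] [Nonempty BO] [Nonempty BO'] :
    NSAdapter.completelyAdmissibleAdapters AI AI' AO AO' BI BI' BO BO' =
      NSAdapter.nonSignallingAdapters AI AI' AO AO' BI BI' BO BO' := by
  exact Set.Subset.antisymm
    (NSAdapter.completelyAdmissibleAdapters_subset AI AI' AO AO' BI BI' BO BO')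
    (NSAdapter.nonSignallingAdapters_subset AI AI' AO AO' BI BI' BO BO')
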